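/- For $0\le q<1$ let $\log_q x=\dfrac{x^{q-1}-1}{q-1}$ for $x>0$, and let $\exp_q x=\bigl(x(q-1)+1\bigr)^{1/(q-1)}$ for $x<-\dfrac1{q-1}$ be its inverse function. Functions are applied to Hermitian matrices by the functional calculus. Let $H_1,\dots,H_k$ be complex matrices, $H_i$ of size $m_i\times n$, with $H_1^*H_1+\cdots+H_k^*H_k=1$, and for positive definite matrices $A_i$ of size $m_i\times m_i$ put $$\varphi(A_1,\dots,A_k)=\operatorname{Tr}\exp_q\Bigl(\sum_{i=1}^k H_i^*\log_q(A_i)H_i\Bigr).$$ Let $0\le q<1$, and let $A_1,\dots,A_k$ and $B_1,\dots,B_k$ be positive definite, with $A_i$ and $B_i$ of size $m_i\times m_i$. Then the map $X\mapsto\log_q(X)$ on Hermitian matrices is Fréchet differentiable at each $A_j$, and $$\varphi(B_1,\dots,B_k)\le\operatorname{Tr}\Bigl[\Bigl(\exp_q\Bigl(\sum_{i=1}^kH_i^*\log_q(A_i)H_i\Bigr)\Bigr)^{2-q}\ \sum_{j=1}^kH_j^*\bigl(\mathrm d\log_q(A_j)B_j\bigr)H_j\Bigr],$$ where $\mathrm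 d\log_q(A_j)B_j$ is the Fréchet derivative of $X\mapsto\log_q(X)$ at $A_j$ in the direction $B_j$. -/

import Mathlib

open scoped ComplexOrder

noncomputable section

/-- The deformed logarithm `log_q`, on positive reals
(the values at `x ≤ 0` are irrelevant). -/
def qLog (q x : ℝ) : ℝ :=
  if q = 1 then Real.log x else (x ^ (q - 1) - 1) / (q - 1)

/-- The deformed exponential `exp_q`, given by its formula on its domain, which is
`x > -1/(q-1)` for `q > 1`, `x < -1/(q-1)` for `q < 1`, and the whole line for `q = 1`
(that is, `x * (q - 1) + 1 > 0`; the values elsewhere are irrelevant). -/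
def qExp (q x : ℝ) : ℝ :=
  if q = 1 then Real.exp x else (x * (q - 1) + 1) ^ (1 / (q - 1))

/-- The real vector space of Hermitian complex matrices. -/
abbrev HermMat (m : Type*) : Type _ := selfAdjoint (Matrix m m ℂ)

/-- The matrix `f(A)` obtained from the Hermitian matrix `A` by applying the real function `f`
to its eigenvalues. -/
def HermMat.map {m : Type*} [Fintype m] [DecidableEq m] (f : ℝ → ℝ) (A : HermMat m) :
    HermMat m :=
  ⟨cfc f (A : Matrix m m ℂ), cfc_predicate f (A : Matrix m m ℂ)⟩

/-- The compression `H* A H` of a Hermitian matrix `A` by a possibly rectangular matrix `H`. -/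
def HermMat.compress {m n : Type*} [Fintype m] (H : Matrix m n ℂ) (A : HermMat m) : HermMat n :=
  ⟨H.conjTranspose * (A : Matrix m m ℂ) * H,
    Matrix.isHermitian_conjTranspose_mul_mul H A.2⟩

/-- `∑ i, H i* log_q(A i) H i`. -/
def qLogSum {ι n : Type*} [Fintype ι] {m : ι → Type*} [∀ i, Fintype (m i)]
    [∀ i, DecidableEq (m i)] (q : ℝ) (H : ∀ i, Matrix (m i) n ℂ) (A : ∀ i, HermMat (m i)) :
    HermMat n :=
  ∑ i, HermMat.compress (H i) (HermMat.map (qLog q) (A i))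

/-- The function `φ(A₁, …, A_k) = Tr exp_q (∑ i, H i* log_q(A i) H i)` of `k`-tuples of positive
definite matrices. The trace of a Hermitian matrix is real; `re` only makes the type `ℝ`. -/
def qPhi {ι n : Type*} [Fintype ι] [Fintype n] [DecidableEq n] {m : ι → Type*}
    [∀ i, Fintype (m i)] [∀ i, DecidableEq (m i)] (q : ℝ) (H : ∀ i, Matrix (m i) n ℂ)
    (A : ∀ i, HermMat (m i)) : ℝ :=
  (Matrix.trace (HermMat.map (qExp q) (qLogSum q H A) : Matrix n n ℂ)).re

/-- The Fréchet derivative `d log_q (A) B` at `A`, in the direction `B`, of the matrix function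
`X ↦ log_q X` on the finite-dimensional real vector space of Hermitian matrices. -/
def dqLog {m : Type*} [Fintype m] [DecidableEq m] (q : ℝ) (A B : HermMat m) : HermMat m :=
  fderiv ℝ (fun X : HermMat m => HermMat.map (qLog q) X) A B

end

section

open Matrix Finset

/-! Put `p = 1 - q` and `Z(A) = ∑ H_i* A_i^(-p) H_i`. Since `∑ H_i* H_i = 1`, the argument of
`exp_q` is `(1 - Z(A)) / p`, so `φ(A) = Tr E(A)` with `E(A) = Z(A)^(-1/p)`. A trace Young
inequality, `(1+p) Tr X - p Tr Z^(-1/p) ≤ Tr X^(1+p) Z`, is an equality at `X = Z^(-1/p)`. The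
functional `(A, X) ↦ Tr X^(1+p) H* A^(-p) H` is homogeneous of degree one and jointly subadditive.
With `C = A + tB`, Young at `X = E(A) + t E(B)`, `Z = Z(C)` and subadditivity give `φ(A) + t φ(B) ≤
φ(C)`. Young at `X = E(C)`, `Z = Z(A)` gives `p (φ(C) - φ(A)) ≤ Tr E(C)^(1+p) (Z(A) - Z(C))`.
Together these bound `t p φ(B)`; dividing by `t p` and letting `t → 0+` gives the claim. Only
`log_q` is differentiated: `exp_q` enters through continuity alone. The carrying lemmas are
`Matrix.trace_young`, `Matrix.trace_rpow_mul_compress_rpow_add_le` and `mul_trace_compressRpow_le`.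
-/

/-! ### Spectral calculus and a variational formula. -/

theorem Matrix.IsHermitian.exists_diagonalization {m : Type*} [Fintype m] [DecidableEq m]
    {A : Matrix m m ℂ} (hA : A.IsHermitian) :
    ∃ (U : Matrix m m ℂ) (a : m → ℝ), Uᴴ * U = 1 ∧ U * Uᴴ = 1 ∧ (∀ i, a i ∈ spectrum ℝ A) ∧
      ∀ f : ℝ → ℝ, cfc f A = U * diagonal (fun i => (f (a i) : ℂ)) * Uᴴ := by
  refine ⟨hA.eigenvectorUnitary, hA.eigenvalues, ?_, ?_, hA.eigenvalues_mem_spectrum_real, ?_⟩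
  · exact Unitary.coe_star_mul_self hA.eigenvectorUnitary
  · exact Unitary.coe_mul_star_self hA.eigenvectorUnitary
  · intro f
    rw [hA.cfc_eq, Matrix.IsHermitian.cfc, Unitary.conjStarAlgAut_apply]
    rfl

theorem Matrix.PosDef.spectrum_pos {m : Type*} [Fintype m] [DecidableEq m]
    {A : Matrix m m ℂ} (hA : A.PosDef) {x : ℝ} (hx : x ∈ spectrum ℝ A) : 0 < x := by
  rw [hA.isHermitian.spectrum_real_eq_range_eigenvalues] at hx
  obtain ⟨i, rfl⟩ := hx
  exact hA.eigenvalues_pos i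

theorem Matrix.continuousOn_real_spectrum {m : Type*} [Fintype m] [DecidableEq m]
    (A : Matrix m m ℂ) (f : ℝ → ℝ) : ContinuousOn f (spectrum ℝ A) :=
  (Matrix.finite_real_spectrum (A := A)).continuousOn f

theorem Matrix.posDef_cfc {m : Type*} [Fintype m] [DecidableEq m]
    {A : Matrix m m ℂ} (hA : A.IsHermitian) {f : ℝ → ℝ} (hf : ∀ x ∈ spectrum ℝ A, 0 < f x) :
    (cfc f A).PosDef := by
  obtain ⟨U, a, hU, hU', ha, h⟩ := hA.exists_diagonalization
  rw [h f]
  have hd : (diagonal (fun i => (f (a i) : ℂ))).PosDef :=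
    Matrix.PosDef.diagonal fun i => by exact_mod_cast hf _ (ha i)
  refine hd.mul_mul_conjTranspose_same ?_
  intro x y hxy
  have := congrArg (fun v => v ᵥ* Uᴴ) hxy
  simpa [Matrix.vecMul_vecMul, hU'] using this

theorem Matrix.trace_diagonal_mul_compress {m n : Type*} [Fintype m] [DecidableEq m] [Fintype n]
    [DecidableEq n] (h : Matrix m n ℂ) (f : n → ℝ) (g : m → ℝ) :
    (trace (diagonal (fun j => (f j : ℂ)) * (hᴴ * diagonal (fun i => (g i : ℂ)) * h))).re =
      ∑ i, ∑ j, Complex.normSq (h i j) * (f j * g i) := by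
  rw [Finset.sum_comm]
  simp only [trace, diag_apply, diagonal_mul, mul_apply (M := hᴴ * diagonal (fun i => (g i : ℂ))),
    mul_diagonal, conjTranspose_apply, Finset.mul_sum, Complex.re_sum]
  refine Finset.sum_congr rfl fun j _ => Finset.sum_congr rfl fun i _ => ?_
  simp [Complex.normSq_apply]
  ring

/-- Simultaneous diagonalization of the two-matrix trace functionals, with the variational formula
for the quadratic-over-linear ones. -/
theorem Matrix.exists_variational_weights {m n : Type*} [Fintype m] [DecidableEq m] [Fintype n]
    [DecidableEq n] (H : Matrix m n ℂ) {A : Matrix m m ℂ} {X : Matrix n n ℂ}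
    (hA : A.PosDef) (hX : X.PosDef) :
    ∃ (w : m → n → ℝ) (a : m → ℝ) (x : n → ℝ),
      (∀ i j, 0 ≤ w i j) ∧ (∀ i, a i ∈ spectrum ℝ A) ∧ (∀ j, x j ∈ spectrum ℝ X) ∧
      (∀ f g : ℝ → ℝ, (trace (cfc f X * (Hᴴ * cfc g A * H))).re =
        ∑ i, ∑ j, w i j * (f (x j) * g (a i))) ∧
      ∀ r s : ℝ, 0 ≤ r → 0 < s →
        (∀ U : Matrix m n ℂ, 2 * (trace (Uᴴ * H * X)).re - r * (trace (Uᴴ * U * X)).re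
          - s * (trace (Uᴴ * A * U)).re ≤ ∑ i, ∑ j, w i j * (x j ^ 2 / (r * x j + s * a i))) ∧
        ∃ U : Matrix m n ℂ, 2 * (trace (Uᴴ * H * X)).re - r * (trace (Uᴴ * U * X)).re
          - s * (trace (Uᴴ * A * U)).re = ∑ i, ∑ j, w i j * (x j ^ 2 / (r * x j + s * a i)) := by
  obtain ⟨V, a, hV, hV', ha, hcA⟩ := hA.isHermitian.exists_diagonalization
  obtain ⟨W, x, hW, hW', hx, hcX⟩ := hX.isHermitian.exists_diagonalization
  have ha0 : ∀ i, 0 < a i := fun i => hA.spectrum_pos (ha i)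
  have hx0 : ∀ j, 0 < x j := fun j => hX.spectrum_pos (hx j)
  have hAe : A = V * diagonal (fun i => (a i : ℂ)) * Vᴴ := by
    conv_lhs => rw [← cfc_id ℝ A hA.isHermitian.isSelfAdjoint]
    rw [hcA]; rfl
  have hXe : X = W * diagonal (fun i => (x i : ℂ)) * Wᴴ := by
    conv_lhs => rw [← cfc_id ℝ X hX.isHermitian.isSelfAdjoint]
    rw [hcX]; rfl
  -- In eigenbases of `A` and `X` the quadratic form in `U` decouples into its entries; the weights
  -- are `|h i j|²`.
  set h : Matrix m n ℂ := Vᴴ * H * W with hh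
  have hform : ∀ (r s : ℝ) (u : Matrix m n ℂ),
      2 * (trace ((V * u * Wᴴ)ᴴ * H * X)).re
        - r * (trace ((V * u * Wᴴ)ᴴ * (V * u * Wᴴ) * X)).re
        - s * (trace ((V * u * Wᴴ)ᴴ * A * (V * u * Wᴴ))).re =
      ∑ i, ∑ j, (2 * (star (u i j) * h i j).re * x j
        - Complex.normSq (u i j) * (r * x j + s * a i)) := by
    intro r s u
    have e1 : trace ((V * u * Wᴴ)ᴴ * H * X) = trace (uᴴ * h * diagonal (fun i => (x i : ℂ))) := by
      rw [hXe, hh, conjTranspose_mul, conjTranspose_mul, conjTranspose_conjTranspose,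
        ← Matrix.mul_assoc, trace_mul_comm]
      simp only [← Matrix.mul_assoc, hW, Matrix.one_mul]
    have e2 : trace ((V * u * Wᴴ)ᴴ * (V * u * Wᴴ) * X) =
        trace (uᴴ * u * diagonal (fun i => (x i : ℂ))) := by
      rw [hXe, conjTranspose_mul, conjTranspose_mul, conjTranspose_conjTranspose,
        ← Matrix.mul_assoc, trace_mul_comm]
      simp only [← Matrix.mul_assoc, hW, Matrix.one_mul]
      rw [Matrix.mul_assoc _ Vᴴ V, hV, Matrix.mul_one, Matrix.mul_assoc _ Wᴴ W, hW, Matrix.mul_one]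
    have e3 : trace ((V * u * Wᴴ)ᴴ * A * (V * u * Wᴴ)) =
        trace (uᴴ * diagonal (fun i => (a i : ℂ)) * u) := by
      rw [hAe, conjTranspose_mul, conjTranspose_mul, conjTranspose_conjTranspose,
        ← Matrix.mul_assoc _ (V * u) Wᴴ, trace_mul_comm]
      simp only [← Matrix.mul_assoc, hW, Matrix.one_mul]
      rw [Matrix.mul_assoc _ Vᴴ V, hV, Matrix.mul_one, Matrix.mul_assoc _ Vᴴ V, hV, Matrix.mul_one]
    rw [e1, e2, e3]
    simp only [trace, diag_apply, mul_diagonal, mul_apply (M := uᴴ) (N := h),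
      mul_apply (M := uᴴ) (N := u), mul_apply (M := uᴴ * diagonal (fun i => (a i : ℂ))), conjTranspose_apply, Complex.re_sum,
      Finset.mul_sum, Finset.sum_mul, ← Finset.sum_sub_distrib]
    rw [Finset.sum_comm]
    refine Finset.sum_congr rfl fun i _ => Finset.sum_congr rfl fun j _ => ?_
    simp [Complex.normSq_apply]
    ring
  refine ⟨fun i j => Complex.normSq (h i j), a, x, fun i j => Complex.normSq_nonneg _, ha, hx,
    ?_, ?_⟩
  · intro f g
    rw [← Matrix.trace_diagonal_mul_compress h (fun j => f (x j)) (fun i => g (a i)), hcX, hcA]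
    congr 1
    rw [hh, conjTranspose_mul, conjTranspose_mul, conjTranspose_conjTranspose, Matrix.mul_assoc W,
      Matrix.mul_assoc W, trace_mul_comm W]
    simp only [Matrix.mul_assoc]
  · intro r s hr hs
    have hden : ∀ i j, 0 < r * x j + s * a i := fun i j =>
      add_pos_of_nonneg_of_pos (mul_nonneg hr (hx0 j).le) (mul_pos hs (ha0 i))
    constructor
    · intro U
      have hU : U = V * (Vᴴ * U * W) * Wᴴ := by
        simp only [← Matrix.mul_assoc, hV', Matrix.one_mul]
        rw [Matrix.mul_assoc, hW', Matrix.mul_one]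
      rw [hU, hform]
      refine Finset.sum_le_sum fun i _ => Finset.sum_le_sum fun j _ => ?_
      set c := (Vᴴ * U * W) i j
      set d := r * x j + s * a i with hd
      have hd0 : 0 < d := hden i j
      rw [← mul_div_assoc, le_div_iff₀ hd0]
      simp only [Complex.normSq_apply, Complex.mul_re, Complex.star_def, Complex.conj_re,
        Complex.conj_im]
      -- Completing the square: `|h x - c d|² ≥ 0`.
      nlinarith [sq_nonneg ((h i j).re * x j - c.re * d), sq_nonneg ((h i j).im * x j - c.im * d)]
    -- The entrywise maximizer, where the square vanishes.
    · refine ⟨V * (of fun i j => ((x j / (r * x j + s * a i) : ℝ) : ℂ) * h i j) * Wᴴ, ?_⟩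
      rw [hform]
      refine Finset.sum_congr rfl fun i _ => Finset.sum_congr rfl fun j _ => ?_
      have := (hden i j).ne'
      simp only [of_apply, Complex.normSq_apply, Complex.mul_re, Complex.star_def, Complex.conj_re,
        Complex.conj_im, Complex.mul_im, Complex.ofReal_re, Complex.ofReal_im]
      set d := r * x j + s * a i with hd
      field_simp
      ring

/-! ### Fréchet differentiability of matrix powers by the binomial series. -/

section

open scoped Matrix.Norms.L2Operator

theorem one_le_binomialSeries_radius (𝔸 : Type*) [NormedRing 𝔸] [NormedAlgebra ℝ 𝔸] (a : ℝ) :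
    1 ≤ (binomialSeries 𝔸 a).radius := by
  refine ENNReal.le_of_forall_nnreal_lt fun r hr => ?_
  obtain ⟨C, hC, h⟩ := (binomialSeries ℝ a).norm_mul_pow_le_of_lt_radius
    (hr.trans_le (binomialSeries_radius_ge_one (𝕂 := ℝ)))
  -- The comparison with the scalar series is used only for `n ≥ 1`; the `max` covers the constant
  -- term.
  refine (binomialSeries 𝔸 a).le_radius_of_bound (max C ‖binomialSeries 𝔸 a 0‖) fun n => ?_
  rcases Nat.eq_zero_or_pos n with rfl | hn
  · simp
  · refine le_max_of_le_left (le_trans ?_ (h n))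
    gcongr
    refine (FormalMultilinearSeries.ofScalars_norm_le (E := 𝔸) (𝕜 := ℝ) _ n hn).trans_eq ?_
    exact (FormalMultilinearSeries.ofScalars_norm (E := ℝ) (𝕜 := ℝ) _ n).symm

theorem Real.hasSum_choose_mul_pow {a x : ℝ} (hx : |x| < 1) :
    HasSum (fun k => Ring.choose a k * x ^ k) ((1 + x) ^ a) := by
  have h := (Real.one_add_rpow_hasFPowerSeriesOnBall_zero (a := a)).hasSum (y := x)
    (by simpa [enorm_eq_nnnorm, ← NNReal.coe_lt_coe] using hx)
  simpa [-FormalMultilinearSeries.apply_eq_prod_smul_coeff] using h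

variable {m : Type*} [Fintype m] [DecidableEq m]

theorem Matrix.hasSum_choose_smul_pow {X : Matrix m m ℂ} (hX : X.IsHermitian) (a : ℝ)
    (hs : ∀ x ∈ spectrum ℝ X, |x| < 1) :
    HasSum (fun k => Ring.choose a k • X ^ k) (cfc (fun x : ℝ => (1 + x) ^ a) X) := by
  obtain ⟨U, x, hU, hU', hx, h⟩ := hX.exists_diagonalization
  have hpow : ∀ k, Ring.choose a k • X ^ k =
      U * diagonal (fun i => ((Ring.choose a k * x i ^ k : ℝ) : ℂ)) * Uᴴ := by
    intro k
    rw [← cfc_pow_id (R := ℝ) X k hX.isSelfAdjoint, ← cfc_const_mul (Ring.choose a k) _ X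
      (X.continuousOn_real_spectrum _), h]
  simp only [hpow]
  rw [h]
  refine HasSum.mul_right _ (HasSum.mul_left _ ?_)
  refine HasSum.matrix_diagonal ?_
  rw [Pi.hasSum]
  intro i
  exact_mod_cast Complex.hasSum_ofReal.mpr (Real.hasSum_choose_mul_pow (a := a) (hs _ (hx i)))

theorem Matrix.norm_cfc_lt {X : Matrix m m ℂ} (hX : X.IsHermitian) {f : ℝ → ℝ} {M : ℝ} (hM : 0 < M)
    (hs : ∀ x ∈ spectrum ℝ X, |f x| < M) : ‖cfc f X‖ < M := by
  obtain ⟨U, x, hU, hU', hx, h⟩ := hX.exists_diagonalization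
  have hmem : U ∈ unitary (Matrix m m ℂ) := ⟨hU, hU'⟩
  rw [h, ← star_eq_conjTranspose, CStarRing.norm_mul_mem_unitary _ (Unitary.star_mem hmem),
    CStarRing.norm_mem_unitary_mul _ hmem, l2_opNorm_diagonal, pi_norm_lt_iff hM]
  intro i
  simpa using hs _ (hx i)

theorem Matrix.abs_le_norm_of_mem_spectrum {X : Matrix m m ℂ}
    {x : ℝ} (hx : x ∈ spectrum ℝ X) : |x| ≤ ‖X‖ := by
  rcases isEmpty_or_nonempty m with h | h
  · simp [spectrum.of_subsingleton] at hx
  · simpa using spectrum.norm_le_norm_of_mem hx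

theorem Matrix.differentiableAt_binomialSeries_sum (a : ℝ) {X : Matrix m m ℂ} (hX : ‖X‖ < 1) :
    DifferentiableAt ℝ (fun Y : Matrix m m ℂ => ∑' k, Ring.choose a k • Y ^ k) X := by
  have hr := one_le_binomialSeries_radius (Matrix m m ℂ) a
  have h := (binomialSeries (Matrix m m ℂ) a).hasFPowerSeriesOnBall (zero_lt_one.trans_le hr)
  have := h.differentiableOn.differentiableAt (x := X) (Metric.isOpen_eball.mem_nhds (by
    refine Metric.eball_subset_eball hr ?_
    simpa [enorm_eq_nnnorm, ← NNReal.coe_lt_coe] using hX))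
  refine this.congr_of_eventuallyEq (Filter.Eventually.of_forall fun Y => ?_)
  simp [FormalMultilinearSeries.sum]


theorem Matrix.IsHermitian.smul_sub_one_eq_cfc {X : Matrix m m ℂ} (hX : X.IsHermitian) (c : ℝ) :
    c • X - 1 = cfc (fun x : ℝ => c * x - 1) X := by
  rw [cfc_sub (fun x : ℝ => c * x) (fun _ => 1) X, cfc_const_mul_id c X hX.isSelfAdjoint,
    cfc_const (1 : ℝ) X hX.isSelfAdjoint, map_one]

theorem Matrix.cfc_rpow_eq_smul_tsum (a : ℝ) {M : ℝ} (hM : 0 < M) {X : Matrix m m ℂ}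
    (hX : X.IsHermitian) (h : ‖M⁻¹ • X - 1‖ < 1) :
    cfc (fun x : ℝ => x ^ a) X = M ^ a • ∑' k, Ring.choose a k • (M⁻¹ • X - 1) ^ k := by
  have hY := hX.smul_sub_one_eq_cfc M⁻¹
  have hYh : (M⁻¹ • X - 1).IsHermitian := by
    rw [hY]
    exact cfc_predicate (R := ℝ) _ X
  have hs : ∀ x ∈ spectrum ℝ (M⁻¹ • X - 1), |x| < 1 := fun x hx =>
    (Matrix.abs_le_norm_of_mem_spectrum hx).trans_lt h
  rw [(Matrix.hasSum_choose_smul_pow hYh a hs).tsum_eq, hY]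
  have hs' : ∀ x ∈ spectrum ℝ X, |M⁻¹ * x - 1| < 1 := by
    intro x hx
    apply hs
    rw [hY, cfc_map_spectrum (fun x : ℝ => M⁻¹ * x - 1) X hX.isSelfAdjoint
      (X.continuousOn_real_spectrum _)]
    exact ⟨x, hx, rfl⟩
  rw [← cfc_comp' (fun x : ℝ => (1 + x) ^ a) (fun x : ℝ => M⁻¹ * x - 1) X
    (((Matrix.finite_real_spectrum (A := X)).image _).continuousOn _)
    (X.continuousOn_real_spectrum _) hX.isSelfAdjoint,
    ← cfc_const_mul (M ^ a) _ X (X.continuousOn_real_spectrum _)]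
  refine cfc_congr fun x hx => ?_
  have hx0 : 0 < M⁻¹ * x := by linarith [(abs_lt.mp (hs' x hx)).1]
  simp only [add_sub_cancel]
  rw [← Real.mul_rpow hM.le hx0.le, mul_inv_cancel_left₀ hM.ne']

/-- `X ↦ X ^ a` is Fréchet differentiable at positive definite matrices. -/
theorem HermMat.differentiableAt_map_rpow (a : ℝ) {A : HermMat m}
    (hA : (A : Matrix m m ℂ).PosDef) :
    DifferentiableAt ℝ (fun X : HermMat m => HermMat.map (fun x => x ^ a) X) A := by
  -- This scaling puts the spectrum of `M⁻¹ A` inside `(0, 1)`, hence `M⁻¹ A - 1` inside the open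
  -- unit ball, where the series converges.
  set M : ℝ := ‖(A : Matrix m m ℂ)‖ + 1 with hMd
  have hM : 0 < M := by positivity
  have hAM : ‖M⁻¹ • (A : Matrix m m ℂ) - 1‖ < 1 := by
    rw [hA.isHermitian.smul_sub_one_eq_cfc]
    refine Matrix.norm_cfc_lt hA.isHermitian one_pos fun x hx => ?_
    have h0 := hA.spectrum_pos hx
    have h1 := (le_abs_self x).trans (Matrix.abs_le_norm_of_mem_spectrum hx)
    have h2 : M⁻¹ * x < 1 := by
      rw [inv_mul_lt_iff₀ hM]; linarith
    have h3 : 0 < M⁻¹ * x := by positivity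
    rw [abs_lt]; constructor <;> linarith
  have hlin : DifferentiableAt ℝ (fun X : HermMat m => M⁻¹ • (X : Matrix m m ℂ) - 1) A :=
    (((selfAdjoint.submodule ℝ (Matrix m m ℂ)).subtypeL.differentiableAt (x := A)).const_smul
      M⁻¹).sub_const 1
  have hopen : ∀ᶠ X : HermMat m in nhds A, ‖M⁻¹ • (X : Matrix m m ℂ) - 1‖ < 1 :=
    hlin.continuousAt.norm.eventually_lt continuousAt_const hAM
  have hS : DifferentiableAt ℝ (fun X : HermMat m =>
      ∑' k, Ring.choose a k • (M⁻¹ • (X : Matrix m m ℂ) - 1) ^ k) A :=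
    DifferentiableAt.fun_comp' A (Matrix.differentiableAt_binomialSeries_sum a hAM) hlin
  -- The series takes values in all matrices; the self-adjoint part brings it back to `HermMat` and
  -- fixes values that are already Hermitian.
  have hP := (selfAdjointPartL ℝ (Matrix m m ℂ)).differentiableAt.comp A (hS.const_smul (M ^ a))
  refine hP.congr_of_eventuallyEq ?_
  filter_upwards [hopen] with X hX
  simp only [Function.comp_apply, Pi.smul_apply]
  rw [← Matrix.cfc_rpow_eq_smul_tsum a hM X.2 hX]
  exact (IsSelfAdjoint.selfAdjointPart_apply ℝ (cfc_predicate (R := ℝ) _ (X : Matrix m m ℂ))).symm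

theorem HermMat.differentiableAt_map_qLog {q : ℝ} (hq : q < 1) {A : HermMat m}
    (hA : (A : Matrix m m ℂ).PosDef) :
    DifferentiableAt ℝ (fun X : HermMat m => HermMat.map (qLog q) X) A := by
  have h := ((HermMat.differentiableAt_map_rpow (q - 1) hA).sub_const 1).const_smul (q - 1)⁻¹
  refine h.congr_of_eventuallyEq (Filter.Eventually.of_forall fun X => ?_)
  refine Subtype.ext ?_
  have e : qLog q = fun x => (q - 1)⁻¹ * (x ^ (q - 1) - 1) := by
    funext x
    rw [qLog, if_neg hq.ne, div_eq_inv_mul]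
  have hc := (X : Matrix m m ℂ).continuousOn_real_spectrum
  change cfc (qLog q) (X : Matrix m m ℂ) =
    (q - 1)⁻¹ • (cfc (fun x : ℝ => x ^ (q - 1)) (X : Matrix m m ℂ) - 1)
  rw [e, cfc_const_mul _ _ _ (hc _), cfc_sub _ _ _ (hc _) (hc _),
    cfc_const (1 : ℝ) (X : Matrix m m ℂ)
      (show IsSelfAdjoint (X : Matrix m m ℂ) from X.2), map_one]

end

/-! ### Trace Young inequality and joint subadditivity. -/

/-- Bernoulli's inequality for the ratio of `x` to `f = z^(-1/p)`, the point of equality. -/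
theorem Real.one_add_mul_sub_le_rpow_mul {p x z : ℝ} (hp : 0 < p) (hx : 0 < x) (hz : 0 < z) :
    (1 + p) * x - p * z ^ (-(1 / p)) ≤ x ^ (1 + p) * z := by
  set f := z ^ (-(1 / p)) with hf
  have hf0 : 0 < f := Real.rpow_pos_of_pos hz _
  have hzf : z = f ^ (-p) := by
    rw [hf, ← Real.rpow_mul hz.le]
    field_simp
    simp
  have h := one_add_mul_self_le_rpow_one_add (s := x / f - 1) (p := 1 + p)
    (by have : 0 < x / f := by positivity
        linarith) (by linarith)
  rw [add_sub_cancel] at h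
  have e : x ^ (1 + p) * z = f * (x / f) ^ (1 + p) := by
    rw [hzf, Real.div_rpow hx.le hf0.le, Real.rpow_neg hf0.le, Real.rpow_add hf0, Real.rpow_one]
    have : f ^ p ≠ 0 := (Real.rpow_pos_of_pos hf0 p).ne'
    field_simp
  rw [e]
  calc (1 + p) * x - p * f = f * (1 + (1 + p) * (x / f - 1)) := by field_simp; ring
    _ ≤ _ := by gcongr

theorem Matrix.trace_young {n : Type*} [Fintype n] [DecidableEq n] {p : ℝ} (hp : 0 < p)
    {X Z : Matrix n n ℂ} (hX : X.PosDef) (hZ : Z.PosDef) :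
    (1 + p) * (trace X).re - p * (trace (cfc (fun x : ℝ => x ^ (-(1 / p))) Z)).re ≤
      (trace (cfc (fun x : ℝ => x ^ (1 + p)) X * Z)).re := by
  -- With `H = 1` all three traces are sums over the same nonnegative weights, so the scalar
  -- inequality suffices although `X` and `Z` need not commute.
  obtain ⟨w, a, x, hw, ha, hx, h, -⟩ := Matrix.exists_variational_weights 1 hZ hX
  have h1 := h id (fun _ => 1)
  have h2 := h (fun _ => 1) (fun x => x ^ (-(1 / p)))
  have h3 := h (fun x => x ^ (1 + p)) id
  have iX := hX.isHermitian.isSelfAdjoint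
  have iZ := hZ.isHermitian.isSelfAdjoint
  rw [cfc_id ℝ X iX, cfc_const (1 : ℝ) Z iZ] at h1
  rw [cfc_const (1 : ℝ) X iX] at h2
  rw [cfc_id ℝ Z iZ] at h3
  simp only [conjTranspose_one, Matrix.one_mul, Matrix.mul_one, map_one] at h1 h2 h3
  rw [h1, h2, h3, Finset.mul_sum, Finset.mul_sum, ← Finset.sum_sub_distrib]
  refine Finset.sum_le_sum fun i _ => ?_
  rw [Finset.mul_sum, Finset.mul_sum, ← Finset.sum_sub_distrib]
  refine Finset.sum_le_sum fun j _ => ?_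
  have := mul_le_mul_of_nonneg_left (Real.one_add_mul_sub_le_rpow_mul hp
    (hX.spectrum_pos (hx j)) (hZ.spectrum_pos (ha i))) (hw i j)
  simp only [id]
  linarith

-- Writes `x^(1+p) a^(-p)`, up to a positive constant, as a mixture of the quadratic-over-linear
-- functions of the variational formula.
open MeasureTheory Set in
theorem Real.integral_rpow_mul_sq_div {p x a : ℝ} (hp : p ∈ Ioo (0 : ℝ) 1) (hx : 0 < x)
    (ha : 0 < a) :
    IntegrableOn (fun t : ℝ => t ^ (p - 1) * (x ^ 2 / (1 * x + t * a))) (Ioi 0) ∧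
      ∫ t in Ioi (0 : ℝ), t ^ (p - 1) * (x ^ 2 / (1 * x + t * a)) =
        (x ^ (1 + p) * a ^ (-p)) * ∫ t in Ioi (0 : ℝ), Real.rpowIntegrand₀₁ p t 1 := by
  have hxa : 0 < x / a := by positivity
  have hE : EqOn (fun t : ℝ => x * Real.rpowIntegrand₀₁ p t (x / a))
      (fun t : ℝ => t ^ (p - 1) * (x ^ 2 / (1 * x + t * a))) (Ioi 0) := by
    intro t ht
    have ht : 0 < t := ht
    simp only
    rw [Real.rpowIntegrand₀₁_eq_pow_div hp ht.le hxa.le]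
    field_simp
    ring
  constructor
  · exact IntegrableOn.congr_fun ((Real.integrableOn_rpowIntegrand₀₁_Ioi hp hxa.le).const_mul x)
      hE measurableSet_Ioi
  · rw [← setIntegral_congr_fun measurableSet_Ioi hE, integral_const_mul,
      Real.integral_rpowIntegrand₀₁_eq_rpow_mul_const hp hxa.le, Real.div_rpow hx.le ha.le,
      Real.rpow_neg ha.le, Real.rpow_add hx, Real.rpow_one]
    ring

open MeasureTheory Set in
theorem Real.integral_sum_weights {m n : Type*} [Fintype m] [Fintype n] {p : ℝ}
    (hp : p ∈ Ioo (0 : ℝ) 1) (w : m → n → ℝ) {a : m → ℝ} {x : n → ℝ} (ha : ∀ i, 0 < a i)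
    (hx : ∀ j, 0 < x j) :
    IntegrableOn (fun t : ℝ => t ^ (p - 1) * ∑ i, ∑ j, w i j * (x j ^ 2 / (1 * x j + t * a i)))
      (Ioi 0) ∧
    ∫ t in Ioi (0 : ℝ), t ^ (p - 1) * ∑ i, ∑ j, w i j * (x j ^ 2 / (1 * x j + t * a i)) =
      (∑ i, ∑ j, w i j * (x j ^ (1 + p) * a i ^ (-p))) *
        ∫ t in Ioi (0 : ℝ), Real.rpowIntegrand₀₁ p t 1 := by
  have h := fun i j => Real.integral_rpow_mul_sq_div hp (hx j) (ha i)
  have e : (fun t : ℝ => t ^ (p - 1) * ∑ i, ∑ j, w i j * (x j ^ 2 / (1 * x j + t * a i))) =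
      fun t => ∑ i, ∑ j, w i j * (t ^ (p - 1) * (x j ^ 2 / (1 * x j + t * a i))) := by
    funext t
    simp only [Finset.mul_sum]
    exact Finset.sum_congr rfl fun i _ => Finset.sum_congr rfl fun j _ => by ring
  have hi : ∀ i, IntegrableOn
      (fun t : ℝ => ∑ j, w i j * (t ^ (p - 1) * (x j ^ 2 / (1 * x j + t * a i)))) (Ioi 0) :=
    fun i => integrable_finsetSum _ fun j _ => (h i j).1.const_mul _
  rw [e]
  constructor
  · exact integrable_finsetSum _ fun i _ => hi i
  · rw [integral_finsetSum _ fun i _ => hi i, Finset.sum_mul]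
    refine Finset.sum_congr rfl fun i _ => ?_
    rw [integral_finsetSum _ fun j _ => (h i j).1.const_mul _, Finset.sum_mul]
    refine Finset.sum_congr rfl fun j _ => ?_
    rw [integral_const_mul, (h i j).2]
    ring

/-- Joint subadditivity (Lieb's and Ando's convexity) of `(A, X) ↦ Tr X^(1+p) H* A^(-p) H`. -/
theorem Matrix.trace_rpow_mul_compress_rpow_add_le {m n : Type*} [Fintype m] [DecidableEq m]
    [Fintype n] [DecidableEq n] {p : ℝ} (hp : 0 < p) (hp1 : p ≤ 1) (H : Matrix m n ℂ)
    {A B : Matrix m m ℂ} {X Y : Matrix n n ℂ} (hA : A.PosDef) (hB : B.PosDef) (hX : X.PosDef)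
    (hY : Y.PosDef) :
    (trace (cfc (fun x : ℝ => x ^ (1 + p)) (X + Y) *
        (Hᴴ * cfc (fun x : ℝ => x ^ (-p)) (A + B) * H))).re ≤
      (trace (cfc (fun x : ℝ => x ^ (1 + p)) X * (Hᴴ * cfc (fun x : ℝ => x ^ (-p)) A * H))).re +
      (trace (cfc (fun x : ℝ => x ^ (1 + p)) Y *
        (Hᴴ * cfc (fun x : ℝ => x ^ (-p)) B * H))).re := by
  obtain ⟨w₀, a₀, x₀, -, ha₀, hx₀, e₀, v₀⟩ :=
    Matrix.exists_variational_weights H (hA.add hB) (hX.add hY)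
  obtain ⟨w₁, a₁, x₁, -, ha₁, hx₁, e₁, v₁⟩ := Matrix.exists_variational_weights H hA hX
  obtain ⟨w₂, a₂, x₂, -, ha₂, hx₂, e₂, v₂⟩ := Matrix.exists_variational_weights H hB hY
  have pa₀ := fun i => (hA.add hB).spectrum_pos (ha₀ i)
  have px₀ := fun i => (hX.add hY).spectrum_pos (hx₀ i)
  have pa₁ := fun i => hA.spectrum_pos (ha₁ i)
  have px₁ := fun i => hX.spectrum_pos (hx₁ i)
  have pa₂ := fun i => hB.spectrum_pos (ha₂ i)
  have px₂ := fun i => hY.spectrum_pos (hx₂ i)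
  have key : ∀ r s : ℝ, 0 ≤ r → 0 < s →
      ∑ i, ∑ j, w₀ i j * (x₀ j ^ 2 / (r * x₀ j + s * a₀ i)) ≤
        ∑ i, ∑ j, w₁ i j * (x₁ j ^ 2 / (r * x₁ j + s * a₁ i)) +
        ∑ i, ∑ j, w₂ i j * (x₂ j ^ 2 / (r * x₂ j + s * a₂ i)) := by
    intro r s hr hs
    -- For fixed `U` the form is linear in `(A, X)`, so the maximizer for the sum is a competitor in
    -- both summands.
    obtain ⟨U, hU⟩ := (v₀ r s hr hs).2
    have h₁ := (v₁ r s hr hs).1 U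
    have h₂ := (v₂ r s hr hs).1 U
    simp only [Matrix.mul_add, Matrix.add_mul, trace_add, Complex.add_re] at hU
    linarith
  rw [e₀, e₁, e₂]
  rcases hp1.lt_or_eq with hp1 | rfl
  · have hpI : p ∈ Set.Ioo (0 : ℝ) 1 := ⟨hp, hp1⟩
    obtain ⟨i₀, j₀⟩ := Real.integral_sum_weights hpI w₀ pa₀ px₀
    obtain ⟨i₁, j₁⟩ := Real.integral_sum_weights hpI w₁ pa₁ px₁
    obtain ⟨i₂, j₂⟩ := Real.integral_sum_weights hpI w₂ pa₂ px₂
    have hc := Real.integral_rpowIntegrand₀₁_one_pos hpI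
    refine le_of_mul_le_mul_right ?_ hc
    rw [add_mul, ← j₀, ← j₁, ← j₂, ← MeasureTheory.integral_add i₁ i₂]
    refine MeasureTheory.setIntegral_mono_on i₀ (i₁.add i₂) measurableSet_Ioi fun t ht => ?_
    rw [← mul_add]
    exact mul_le_mul_of_nonneg_left (key 1 t zero_le_one ht) (Real.rpow_nonneg (le_of_lt ht) _)
  -- At `p = 1` no integral is needed: `r = 0`, `s = 1` already gives `x² / a`.
  · have h := key 0 1 le_rfl one_pos
    norm_num [Real.rpow_neg_one, ← div_eq_mul_inv] at h ⊢
    exact h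

/-! ### Homogeneity, compressions and the rewriting of `φ` through `Z`. -/

theorem Matrix.cfc_rpow_smul {m : Type*} [Fintype m] [DecidableEq m] {A : Matrix m m ℂ}
    (hA : A.PosDef) (a : ℝ) {t : ℝ} (ht : 0 < t) :
    cfc (fun x : ℝ => x ^ a) (t • A) = t ^ a • cfc (fun x : ℝ => x ^ a) A := by
  rw [← cfc_comp_const_mul t (fun x : ℝ => x ^ a) A
    (((Matrix.finite_real_spectrum (A := A)).image _).continuousOn _) hA.isHermitian.isSelfAdjoint,
    ← cfc_const_mul (t ^ a) _ A (A.continuousOn_real_spectrum _)]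
  exact cfc_congr fun x hx => Real.mul_rpow ht.le (hA.spectrum_pos hx).le

/-- The equality case of the trace Young inequality. -/
theorem Matrix.cfc_rpow_cfc_rpow_mul_self {n : Type*} [Fintype n] [DecidableEq n] {p : ℝ}
    (hp : 0 < p) {Z : Matrix n n ℂ} (hZ : Z.PosDef) :
    cfc (fun x : ℝ => x ^ (1 + p)) (cfc (fun x : ℝ => x ^ (-(1 / p))) Z) * Z =
      cfc (fun x : ℝ => x ^ (-(1 / p))) Z := by
  have iZ := hZ.isHermitian.isSelfAdjoint
  rw [← cfc_comp' (fun x : ℝ => x ^ (1 + p)) (fun x : ℝ => x ^ (-(1 / p))) Z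
    (((Matrix.finite_real_spectrum (A := Z)).image _).continuousOn _)
    (Z.continuousOn_real_spectrum _) iZ]
  nth_rw 2 [← cfc_id ℝ Z iZ]
  rw [← cfc_mul _ _ Z (Z.continuousOn_real_spectrum _) (Z.continuousOn_real_spectrum _)]
  refine cfc_congr fun x hx => ?_
  have hx0 := hZ.spectrum_pos hx
  simp only [id]
  rw [← Real.rpow_mul hx0.le, ← Real.rpow_add_one hx0.ne']
  congr 1
  field_simp
  ring

theorem Matrix.posDef_sum_compress {ι n : Type*} [Fintype ι] [Fintype n] [DecidableEq n]
    {m : ι → Type*} [∀ i, Fintype (m i)] {H : ∀ i, Matrix (m i) n ℂ}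
    (hH : ∑ i, (H i)ᴴ * H i = 1) {P : ∀ i, Matrix (m i) (m i) ℂ} (hP : ∀ i, (P i).PosDef) :
    (∑ i, (H i)ᴴ * P i * H i).PosDef := by
  have hps : ∀ i, ((H i)ᴴ * P i * H i).PosSemidef := fun i =>
    (hP i).posSemidef.conjTranspose_mul_mul_same (H i)
  refine Matrix.PosDef.of_dotProduct_mulVec_pos
    (Matrix.posSemidef_sum _ fun i _ => hps i).isHermitian fun x hx => ?_
  have hterm : ∀ i, star x ⬝ᵥ (((H i)ᴴ * P i * H i) *ᵥ x) =
      star (H i *ᵥ x) ⬝ᵥ (P i *ᵥ (H i *ᵥ x)) := by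
    intro i
    rw [star_mulVec, ← dotProduct_mulVec, mulVec_mulVec, mulVec_mulVec, Matrix.mul_assoc]
  rw [sum_mulVec, dotProduct_sum]
  -- Each summand is only semidefinite; `∑ H_i* H_i = 1` prevents all `H_i x` from vanishing.
  obtain ⟨i, hi⟩ : ∃ i, H i *ᵥ x ≠ 0 := by
    by_contra! hc
    apply hx
    rw [← one_mulVec x, ← hH, sum_mulVec]
    exact Finset.sum_eq_zero fun i _ => by rw [← mulVec_mulVec, hc i, mulVec_zero]
  refine Finset.sum_pos' (fun i _ => (hps i).dotProduct_mulVec_nonneg x) ⟨i, mem_univ i, ?_⟩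
  rw [hterm]
  exact (hP i).dotProduct_mulVec_pos hi

/-- `∑ i, H i* (A i)^(-p) H i`. -/
noncomputable def compressRpow {ι n : Type*} [Fintype ι] {m : ι → Type*} [∀ i, Fintype (m i)]
    [∀ i, DecidableEq (m i)] (p : ℝ) (H : ∀ i, Matrix (m i) n ℂ) (A : ∀ i, HermMat (m i)) :
    HermMat n :=
  ∑ i, HermMat.compress (H i) (HermMat.map (fun x => x ^ (-p)) (A i))

theorem coe_sum_compress {ι n : Type*} [Fintype ι] {m : ι → Type*} [∀ i, Fintype (m i)]
    {H : ∀ i, Matrix (m i) n ℂ} (P : ∀ i, HermMat (m i)) :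
    ((∑ i, HermMat.compress (H i) (P i) : HermMat n) : Matrix n n ℂ) =
      ∑ i, (H i)ᴴ * (P i : Matrix (m i) (m i) ℂ) * H i := by
  rw [AddSubgroup.val_finsetSum]
  rfl

theorem coe_compressRpow {ι n : Type*} [Fintype ι] {m : ι → Type*} [∀ i, Fintype (m i)]
    [∀ i, DecidableEq (m i)] {p : ℝ} {H : ∀ i, Matrix (m i) n ℂ} {A : ∀ i, HermMat (m i)} :
    (compressRpow p H A : Matrix n n ℂ) =
      ∑ i, (H i)ᴴ * cfc (fun x : ℝ => x ^ (-p)) (A i : Matrix (m i) (m i) ℂ) * H i :=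
  coe_sum_compress _

section

variable {ι n : Type*} [Fintype ι] [Fintype n] [DecidableEq n] {m : ι → Type*}
  [∀ i, Fintype (m i)] [∀ i, DecidableEq (m i)] {p q : ℝ} {H : ∀ i, Matrix (m i) n ℂ}
  {A B : ∀ i, HermMat (m i)}

theorem HermMat.posDef_map_rpow {A : HermMat n} (hA : (A : Matrix n n ℂ).PosDef) (a : ℝ) :
    (HermMat.map (fun x => x ^ a) A : Matrix n n ℂ).PosDef :=
  Matrix.posDef_cfc hA.isHermitian fun _ hx => Real.rpow_pos_of_pos (hA.spectrum_pos hx) a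

theorem posDef_compressRpow (hH : ∑ i, (H i)ᴴ * H i = 1)
    (hA : ∀ i, (A i : Matrix (m i) (m i) ℂ).PosDef) :
    (compressRpow p H A : Matrix n n ℂ).PosDef := by
  rw [coe_compressRpow]
  exact Matrix.posDef_sum_compress hH fun i => HermMat.posDef_map_rpow (hA i) (-p)

theorem coe_map_qLog (hq : q < 1) {k : Type*} [Fintype k] [DecidableEq k] (A : HermMat k) :
    (HermMat.map (qLog q) A : Matrix k k ℂ) =
      (1 - q)⁻¹ • (1 - cfc (fun x : ℝ => x ^ (-(1 - q))) (A : Matrix k k ℂ)) := by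
  have e : qLog q = fun x => (1 - q)⁻¹ * (1 - x ^ (-(1 - q))) := by
    funext x
    have h1 : q - 1 ≠ 0 := by linarith
    have h2 : 1 - q ≠ 0 := by linarith
    rw [qLog, if_neg hq.ne, neg_sub]
    field_simp
    ring
  have hc := (A : Matrix k k ℂ).continuousOn_real_spectrum
  change cfc (qLog q) (A : Matrix k k ℂ) = _
  rw [e, cfc_const_mul _ _ _ (hc _), cfc_sub _ _ _ (hc _) (hc _),
    cfc_const (1 : ℝ) (A : Matrix k k ℂ) (show IsSelfAdjoint (A : Matrix k k ℂ) from A.2), map_one]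

theorem coe_qLogSum (hq : q < 1) (hH : ∑ i, (H i)ᴴ * H i = 1) :
    (qLogSum q H A : Matrix n n ℂ) =
      (1 - q)⁻¹ • (1 - (compressRpow (1 - q) H A : Matrix n n ℂ)) := by
  rw [qLogSum, coe_sum_compress, coe_compressRpow, ← hH, ← Finset.sum_sub_distrib, Finset.smul_sum]
  refine Finset.sum_congr rfl fun i _ => ?_
  rw [coe_map_qLog hq, Matrix.mul_smul, Matrix.smul_mul, Matrix.mul_sub, Matrix.sub_mul,
    Matrix.mul_one]

theorem map_qExp_qLogSum (hq : q < 1) (hH : ∑ i, (H i)ᴴ * H i = 1) :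
    HermMat.map (qExp q) (qLogSum q H A) =
      HermMat.map (fun x => x ^ (-(1 / (1 - q)))) (compressRpow (1 - q) H A) := by
  refine Subtype.ext ?_
  change cfc (qExp q) (qLogSum q H A : Matrix n n ℂ) = cfc _ _
  set Z := (compressRpow (1 - q) H A : Matrix n n ℂ) with hZ
  have iZ : IsSelfAdjoint Z := (compressRpow (1 - q) H A).2
  have hc := Z.continuousOn_real_spectrum
  have e : (qLogSum q H A : Matrix n n ℂ) = cfc (fun x : ℝ => (1 - q)⁻¹ * (1 - x)) Z := by
    rw [coe_qLogSum hq hH, cfc_const_mul _ _ _ (hc _), cfc_sub _ _ _ (hc _) (hc _),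
      cfc_const (1 : ℝ) Z iZ, cfc_id' ℝ Z iZ, map_one]
  rw [e, ← cfc_comp' (qExp q) _ Z (((Matrix.finite_real_spectrum (A := Z)).image _).continuousOn _)
    (hc _) iZ]
  refine cfc_congr fun x _ => ?_
  have h1 : q - 1 ≠ 0 := by linarith
  have h2 : 1 - q ≠ 0 := by linarith
  simp only [qExp, if_neg hq.ne]
  congr 1
  · field_simp
    ring
  · rw [← neg_sub q 1, one_div, one_div, inv_neg, neg_neg]

/-! ### The finite-difference inequality and its limit. -/

theorem mul_trace_compressRpow_le (hp : 0 < p) (hp1 : p ≤ 1) (hH : ∑ i, (H i)ᴴ * H i = 1)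
    (hA : ∀ i, (A i : Matrix (m i) (m i) ℂ).PosDef)
    (hB : ∀ i, (B i : Matrix (m i) (m i) ℂ).PosDef) {t : ℝ} (ht : 0 < t) :
    t * p * (trace (HermMat.map (fun x => x ^ (-(1 / p))) (compressRpow p H B) :
        Matrix n n ℂ)).re ≤
      (trace ((HermMat.map (fun x => x ^ (1 + p)) (HermMat.map (fun x => x ^ (-(1 / p)))
          (compressRpow p H fun i => A i + t • B i)) : Matrix n n ℂ) *
        ((compressRpow p H A : Matrix n n ℂ) -
          ((compressRpow p H fun i => A i + t • B i : HermMat n) : Matrix n n ℂ)))).re := by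
  have hC : ∀ i, ((A i + t • B i : HermMat (m i)) : Matrix (m i) (m i) ℂ).PosDef := fun i =>
    (hA i).add ((hB i).smul ht)
  have zA := posDef_compressRpow (p := p) hH hA
  have zB := posDef_compressRpow (p := p) hH hB
  have zC := posDef_compressRpow (p := p) hH hC
  have eA := HermMat.posDef_map_rpow zA (-(1 / p))
  have eB := HermMat.posDef_map_rpow zB (-(1 / p))
  have eC := HermMat.posDef_map_rpow zC (-(1 / p))
  have y₁ := Matrix.trace_young hp (eA.add (eB.smul ht)) zC
  have y₂ := Matrix.trace_young hp eC zA
  have uA := Matrix.cfc_rpow_cfc_rpow_mul_self hp zA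
  have uB := Matrix.cfc_rpow_cfc_rpow_mul_self hp zB
  have uC := Matrix.cfc_rpow_cfc_rpow_mul_self hp zC
  have j : (trace (cfc (fun x : ℝ => x ^ (1 + p))
      ((HermMat.map (fun x => x ^ (-(1 / p))) (compressRpow p H A) : Matrix n n ℂ) +
        t • (HermMat.map (fun x => x ^ (-(1 / p))) (compressRpow p H B) : Matrix n n ℂ)) *
        ((compressRpow p H fun i => A i + t • B i : HermMat n) : Matrix n n ℂ))).re ≤
      (trace (HermMat.map (fun x => x ^ (-(1 / p))) (compressRpow p H A) : Matrix n n ℂ)).re +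
      t * (trace (HermMat.map (fun x => x ^ (-(1 / p))) (compressRpow p H B) :
        Matrix n n ℂ)).re := by
    have s := Finset.sum_le_sum fun i (_ : i ∈ univ) =>
      Matrix.trace_rpow_mul_compress_rpow_add_le hp hp1 (H i) (hA i) ((hB i).smul ht) eA
        (eB.smul ht)
    rw [Finset.sum_add_distrib] at s
    simp only [← Complex.re_sum, ← trace_sum, ← Finset.mul_sum] at s
    have hB' : ∑ i, (H i)ᴴ * cfc (fun x : ℝ => x ^ (-p)) (t • (B i : Matrix (m i) (m i) ℂ)) * H i =
        t ^ (-p) • (compressRpow p H B : Matrix n n ℂ) := by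
      rw [coe_compressRpow, Finset.smul_sum]
      refine Finset.sum_congr rfl fun i _ => ?_
      rw [Matrix.cfc_rpow_smul (hB i) _ ht, Matrix.mul_smul, Matrix.smul_mul]
    -- The factors `t^(1+p)` and `t^(-p)` combine to `t`: homogeneity of degree one.
    rw [hB', Matrix.cfc_rpow_smul eB _ ht, Matrix.smul_mul, Matrix.mul_smul, smul_smul,
      ← Real.rpow_add ht, ← coe_compressRpow] at s
    have h1 : 1 + p + -p = 1 := by ring
    rw [h1, Real.rpow_one] at s
    change _ ≤ (trace (cfc (fun x : ℝ => x ^ (1 + p)) (cfc (fun x : ℝ => x ^ (-(1 / p)))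
      (compressRpow p H A : Matrix n n ℂ)) * (compressRpow p H A : Matrix n n ℂ))).re +
      (trace (t • (cfc (fun x : ℝ => x ^ (1 + p)) (cfc (fun x : ℝ => x ^ (-(1 / p)))
      (compressRpow p H B : Matrix n n ℂ)) * (compressRpow p H B : Matrix n n ℂ)))).re at s
    rw [uA, uB, trace_smul, Complex.smul_re, smul_eq_mul] at s
    rw [coe_compressRpow (A := fun i => A i + t • B i)]
    exact s
  rw [trace_add, trace_smul, Complex.add_re, Complex.smul_re, smul_eq_mul] at y₁
  rw [Matrix.mul_sub, trace_sub, Complex.sub_re]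
  change _ ≤ _ - (trace (cfc (fun x : ℝ => x ^ (1 + p)) (cfc (fun x : ℝ => x ^ (-(1 / p)))
    (compressRpow p H fun i => A i + t • B i : HermMat n).1) *
      (compressRpow p H fun i => A i + t • B i : HermMat n).1)).re
  rw [uC]
  have k := y₁.trans j
  unfold HermMat.map at k y₂ ⊢
  simp only at k y₂ ⊢
  linarith

open Filter Topology in
open scoped Matrix.Norms.L2Operator in
theorem qPhi_le_trace_mul_dqLog (hq0 : 0 ≤ q) (hq1 : q < 1) (hH : ∑ i, (H i)ᴴ * H i = 1)
    (hA : ∀ i, (A i : Matrix (m i) (m i) ℂ).PosDef)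
    (hB : ∀ i, (B i : Matrix (m i) (m i) ℂ).PosDef) :
    qPhi q H B ≤
      (trace ((HermMat.map (fun x => x ^ (2 - q)) (HermMat.map (qExp q) (qLogSum q H A)) :
          Matrix n n ℂ) *
        ∑ j, (H j)ᴴ * (dqLog q (A j) (B j) : Matrix (m j) (m j) ℂ) * H j)).re := by
  have hp : 0 < 1 - q := by linarith
  set W : ℝ → HermMat n := fun t => HermMat.map (fun x => x ^ (1 + (1 - q)))
    (HermMat.map (fun x => x ^ (-(1 / (1 - q))))
      (compressRpow (1 - q) H fun i => A i + t • B i)) with hW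
  set D : ∀ i, ℝ → HermMat (m i) := fun i t =>
    t⁻¹ • (HermMat.map (qLog q) (A i + t • B i) - HermMat.map (qLog q) (A i)) with hD
  have hDlim : ∀ i, Tendsto (D i) (𝓝[>] 0) (𝓝 (dqLog q (A i) (B i))) := fun i =>
    ((HermMat.differentiableAt_map_qLog hq1 (hA i)).hasFDerivAt.hasLineDerivAt
      (B i)).tendsto_slope_zero_right
  have hWlim : Tendsto W (𝓝[>] 0) (𝓝 (W 0)) := by
    refine ContinuousAt.tendsto (f := W) ?_ |>.mono_left nhdsWithin_le_nhds
    have z0 : ((compressRpow (1 - q) H fun i => A i + (0 : ℝ) • B i : HermMat n) :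
        Matrix n n ℂ).PosDef := posDef_compressRpow hH fun i => by simpa using hA i
    have c1 : ContinuousAt (fun t : ℝ => compressRpow (1 - q) H fun i => A i + t • B i) 0 := by
      unfold compressRpow
      refine tendsto_finsetSum _ fun i _ => ?_
      have hcomp : Continuous (HermMat.compress (H i)) := by
        unfold HermMat.compress
        fun_prop
      have hl : ContinuousAt (fun t : ℝ => A i + t • B i) 0 := by fun_prop
      have hm : ContinuousAt (fun X : HermMat (m i) => HermMat.map (fun x => x ^ (-(1 - q))) X)
          (A i + (0 : ℝ) • B i) :=
        (HermMat.differentiableAt_map_rpow _ (by simpa using hA i)).continuousAt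
      exact (hcomp.tendsto _).comp (Tendsto.comp hm hl)
    have c2 := (HermMat.differentiableAt_map_rpow (-(1 / (1 - q))) z0).continuousAt
    have c3 := (HermMat.differentiableAt_map_rpow (1 + (1 - q))
      (HermMat.posDef_map_rpow z0 (-(1 / (1 - q))))).continuousAt
    exact Tendsto.comp c3 (Tendsto.comp c2 c1)
  have hlim : Tendsto (fun t => (trace ((W t : Matrix n n ℂ) *
      ∑ j, (H j)ᴴ * (D j t : Matrix (m j) (m j) ℂ) * H j)).re) (𝓝[>] 0)
      (𝓝 (trace ((W 0 : Matrix n n ℂ) *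
        ∑ j, (H j)ᴴ * (dqLog q (A j) (B j) : Matrix (m j) (m j) ℂ) * H j)).re) := by
    have hs : Tendsto (fun t => ∑ j, (H j)ᴴ * (D j t : Matrix (m j) (m j) ℂ) * H j) (𝓝[>] 0)
        (𝓝 (∑ j, (H j)ᴴ * (dqLog q (A j) (B j) : Matrix (m j) (m j) ℂ) * H j)) := by
      refine tendsto_finsetSum _ fun j _ => ?_
      have hc : Continuous fun X : HermMat (m j) => (H j)ᴴ * (X : Matrix (m j) (m j) ℂ) * H j := by
        fun_prop
      exact (hc.tendsto _).comp (hDlim j)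
    have hw : Tendsto (fun t => (W t : Matrix n n ℂ)) (𝓝[>] 0) (𝓝 (W 0 : Matrix n n ℂ)) :=
      (continuous_subtype_val.tendsto _).comp hWlim
    have hc : Continuous fun X : Matrix n n ℂ => (trace X).re :=
      Complex.continuous_re.comp (continuous_id.matrix_trace)
    exact (hc.tendsto _).comp (hw.mul hs)
  have hW0 : W 0 =
      HermMat.map (fun x => x ^ (2 - q)) (HermMat.map (qExp q) (qLogSum q H A)) := by
    rw [map_qExp_qLogSum hq1 hH, hW]
    simp only [zero_smul, add_zero]
    congr 1
    funext x
    congr 1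
    ring
  rw [← hW0]
  refine ge_of_tendsto hlim ?_
  filter_upwards [self_mem_nhdsWithin] with t ht
  have ht : 0 < t := ht
  have h := mul_trace_compressRpow_le hp (by linarith) hH hA hB ht
  -- `log_q` is affine in the power `-(1 - q)` with slope `-1/(1 - q)`, so this difference is `t (1
  -- - q)` times the compressed difference quotient of `log_q`.
  have hdiff : (compressRpow (1 - q) H A : Matrix n n ℂ) -
      ((compressRpow (1 - q) H fun i => A i + t • B i : HermMat n) : Matrix n n ℂ) =
      (t * (1 - q)) • ∑ j, (H j)ᴴ * (D j t : Matrix (m j) (m j) ℂ) * H j := by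
    rw [coe_compressRpow, coe_compressRpow, ← Finset.sum_sub_distrib, Finset.smul_sum]
    refine Finset.sum_congr rfl fun i _ => ?_
    have e : (D i t : Matrix (m i) (m i) ℂ) = (t * (1 - q))⁻¹ •
        (cfc (fun x : ℝ => x ^ (-(1 - q))) (A i : Matrix (m i) (m i) ℂ) -
          cfc (fun x : ℝ => x ^ (-(1 - q)))
            ((A i + t • B i : HermMat (m i)) : Matrix (m i) (m i) ℂ)) := by
      change t⁻¹ • ((HermMat.map (qLog q) (A i + t • B i) : Matrix (m i) (m i) ℂ) -
        (HermMat.map (qLog q) (A i) : Matrix (m i) (m i) ℂ)) = _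
      rw [coe_map_qLog hq1, coe_map_qLog hq1, ← smul_sub, smul_smul, sub_sub_sub_cancel_left,
        mul_inv]
    rw [e, Matrix.mul_smul, Matrix.smul_mul, smul_smul, mul_inv_cancel₀ (mul_pos ht hp).ne',
      one_smul, Matrix.mul_sub, Matrix.sub_mul]
  rw [hdiff, Matrix.mul_smul, trace_smul, Complex.smul_re, smul_eq_mul] at h
  rw [qPhi, map_qExp_qLogSum hq1 hH]
  exact le_of_mul_le_mul_left h (mul_pos ht hp)

end

end

theorem corollary5p2 {k : ℕ} {n : Type*} [Fintype n] [DecidableEq n] {m : Fin k → Type*}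
    [∀ i, Fintype (m i)] [∀ i, DecidableEq (m i)] (q : ℝ) (hq0 : 0 ≤ q) (hq1 : q < 1)
    (H : ∀ i, Matrix (m i) n ℂ) (hH : ∑ i, (H i).conjTranspose * H i = 1)
    (A B : ∀ i, HermMat (m i))
    (hA : ∀ i, (A i : Matrix (m i) (m i) ℂ).PosDef)
    (hB : ∀ i, (B i : Matrix (m i) (m i) ℂ).PosDef) :
    (∀ i, DifferentiableAt ℝ (fun X : HermMat (m i) => HermMat.map (qLog q) X) (A i)) ∧
    qPhi q H B ≤
      (Matrix.trace
        ((HermMat.map (fun x => x ^ (2 - q)) (HermMat.map (qExp q) (qLogSum q H A)) :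
            Matrix n n ℂ) *
          ∑ j, (H j).conjTranspose * (dqLog q (A j) (B j) : Matrix (m j) (m j) ℂ) * H j)).re :=
  ⟨fun i => HermMat.differentiableAt_map_qLog hq1 (hA i),
    qPhi_le_trace_mul_dqLog hq0 hq1 hH hA hB⟩
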